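/- Let $K$ be a field of characteristic zero and let $\mathcal A$ be a unital associative $K$-algebra (not necessarily commutative), with identity element $1_{\mathcal A}$. Let $\delta:\mathcal A\to\mathcal A$ be a $K$-linear map which is either a $K$-derivation, i.e. $\delta(ab)=\delta(a)b+a\delta(b)$ for all $a,b\in\mathcal A$, or a $K$-$\mathcal E$-derivation, i.e. $\delta(ab)=\delta(a)b+a\delta(b)-\delta(a)\delta(b)$ for all $a,b\in\mathcal A$. Assume that $\delta$ is locally finite, i.e. for each $a\in\mathcal A$ the $K$-subspace of $\mathcal A$ spanned by $\delta^i(a)$ $(i\ge 0)$ is finite dimensional over $K$. Then $1_{\mathcal A}\in\operatorname{im}\delta:=\delta(\mathcal A)$ if and only if $\delta$ is surjective. -/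

import Mathlib

/-- A `K`-linear endomorphism `η` of a `K`-module `V` is locally finite if, for each `a`, the
`K`-subspace spanned by the elements `η^i(a)` (`i ≥ 0`) is finite dimensional over `K`. -/
def IsLocallyFiniteEnd {K V : Type*} [Field K] [AddCommGroup V] [Module K V]
    (η : V →ₗ[K] V) : Prop :=
  ∀ a : V, FiniteDimensional K (Submodule.span K (Set.range fun i : ℕ => (η ^ i) a))

/-- A `K`-derivation of a (not necessarily commutative) `K`-algebra `A`: a `K`-linear map
`D : A → A` with `D(ab) = D(a)b + aD(b)`. Mathlib's `Derivation` covers only commutative `A`. -/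
def IsKDerivation {K A : Type*} [Field K] [Ring A] [Algebra K A] (D : A →ₗ[K] A) : Prop :=
  ∀ a b : A, D (a * b) = D a * b + a * D b

/-- A `K`-`ℰ`-derivation of a (not necessarily commutative) `K`-algebra `A`: a `K`-linear map
`δ : A → A` with `δ(ab) = δ(a)b + aδ(b) - δ(a)δ(b)`. -/
def IsKEDerivation {K A : Type*} [Field K] [Ring A] [Algebra K A] (δ : A →ₗ[K] A) : Prop :=
  ∀ a b : A, δ (a * b) = δ a * b + a * δ b - δ a * δ b

/-! Both kinds of maps satisfy `δ(ab) = δ(a)b + aδ(b) + w δ(a)δ(b)`, with `w = 0` and `w = -1`. By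
Fitting's lemma on orbit spans, a locally finite `δ` is surjective as soon as its image contains
every `a` with `δⁿ(a) = 0`. If `δ(u) = 1`, then `qₖ = u(u - w)⋯(u - (k - 1)w) / k!` satisfies
`δ(qₖ₊₁) = qₖ` and `q₀ = 1`, so repeated integration by parts reaches every such `a = q₀a`: the
identity `qₖa = δ(qₖ₊₁a) - qₖ₊₁δ(a) - w qₖδ(a)` trades `a` for `δ(a)`. -/

section InvariantSubmodule

variable {R V : Type*} [CommRing R] [AddCommGroup V] [Module R V]

theorem le_maxGenEigenspace_zero_sup_range {η : Module.End R V} {W : Submodule R V}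
    [IsArtinian R W] (hW : W ∈ η.invtSubmodule) :
    W ≤ η.maxGenEigenspace 0 ⊔ LinearMap.range η := by
  intro a ha
  have coe_pow (n : ℕ) (x : W) : ((η.restrict hW ^ n) x : V) = (η ^ n) x := by
    rw [Module.End.pow_restrict n hW, LinearMap.coe_restrict_apply]
  obtain ⟨n, hn⟩ := Filter.eventually_atTop.1
    (LinearMap.eventually_codisjoint_ker_pow_range_pow (η.restrict hW))
  obtain ⟨b, hb, _, ⟨c, rfl⟩, hbc⟩ := Submodule.mem_sup.1
    ((hn (n + 1) n.le_succ).eq_top.ge (Submodule.mem_top (x := ⟨a, ha⟩)))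
  have b_mem : (b : V) ∈ η.maxGenEigenspace 0 := by
    refine (η.mem_maxGenEigenspace 0 b).2 ⟨n + 1, ?_⟩
    rw [zero_smul, sub_zero, ← coe_pow, LinearMap.mem_ker.1 hb, Submodule.coe_zero]
  have c_mem : (η ^ (n + 1)) (c : V) ∈ LinearMap.range η :=
    ⟨(η ^ n) c, by rw [pow_succ', Module.End.mul_apply]⟩
  have a_eq : (b : V) + (η ^ (n + 1)) c = a := by
    rw [← coe_pow, ← Submodule.coe_add, hbc]
  exact a_eq ▸ Submodule.add_mem_sup b_mem c_mem

theorem span_range_pow_apply_mem_invtSubmodule (η : Module.End R V) (a : V) :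
    Submodule.span R (Set.range fun i : ℕ => (η ^ i) a) ∈ η.invtSubmodule := by
  refine η.mem_invtSubmodule.2 (Submodule.span_le.2 ?_)
  rintro _ ⟨i, rfl⟩
  exact Submodule.subset_span ⟨i + 1, by simp only [pow_succ', Module.End.mul_apply]⟩

end InvariantSubmodule

theorem IsLocallyFiniteEnd.maxGenEigenspace_zero_sup_range {K V : Type*} [Field K]
    [AddCommGroup V] [Module K V] {η : V →ₗ[K] V} (hη : IsLocallyFiniteEnd η) :
    Module.End.maxGenEigenspace η 0 ⊔ LinearMap.range η = ⊤ := by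
  refine Submodule.eq_top_iff'.2 fun a => ?_
  have := hη a
  exact le_maxGenEigenspace_zero_sup_range (span_range_pow_apply_mem_invtSubmodule η a)
    (Submodule.subset_span ⟨0, by simp only [pow_zero, Module.End.one_apply]⟩)

/-- A derivation of weight `w` of a (not necessarily associative) algebra. It covers
derivations (`w = 0`) and `ℰ`-derivations (`w = -1`) at once. -/
def IsDerivationOfWeight {R A : Type*} [CommRing R] [NonUnitalNonAssocRing A] [Module R A]
    (w : R) (δ : A →ₗ[R] A) : Prop :=
  ∀ a b : A, δ (a * b) = δ a * b + a * δ b + w • (δ a * δ b)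

theorem IsKDerivation.isDerivationOfWeight_zero {K A : Type*} [Field K] [Ring A] [Algebra K A]
    {δ : A →ₗ[K] A} (hδ : IsKDerivation δ) : IsDerivationOfWeight (0 : K) δ := fun a b => by
  rw [hδ, zero_smul, add_zero]

theorem IsKEDerivation.isDerivationOfWeight_neg_one {K A : Type*} [Field K] [Ring A]
    [Algebra K A] {δ : A →ₗ[K] A} (hδ : IsKEDerivation δ) :
    IsDerivationOfWeight (-1 : K) δ := fun a b => by
  rw [hδ, neg_one_smul, sub_eq_add_neg]

theorem IsDerivationOfWeight.mul_mem_range_of_pow_apply_eq_zero {R A : Type*} [CommRing R]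
    [NonUnitalNonAssocRing A] [Module R A] {w : R} {δ : A →ₗ[R] A}
    (hδ : IsDerivationOfWeight w δ) {q : ℕ → A} (hq : ∀ k, δ (q (k + 1)) = q k) {n : ℕ} {a : A}
    (ha : (δ ^ n) a = 0) (k : ℕ) : q k * a ∈ LinearMap.range δ := by
  induction n generalizing a k with
  | zero =>
    rw [pow_zero, Module.End.one_apply] at ha
    rw [ha, mul_zero]
    exact zero_mem _
  | succ n ih =>
    have mul_apply_mem (j : ℕ) : q j * δ a ∈ LinearMap.range δ :=
      ih (by rwa [pow_succ, Module.End.mul_apply] at ha) j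
    have by_parts : q k * a = δ (q (k + 1) * a) - q (k + 1) * δ a - w • (q k * δ a) := by
      rw [hδ, hq]
      abel
    rw [by_parts]
    exact sub_mem (sub_mem (LinearMap.mem_range_self δ _) (mul_apply_mem (k + 1)))
      (Submodule.smul_mem _ w (mul_apply_mem k))

section WeightedBinomial

variable {K A : Type*} [Field K] [NonAssocRing A] [Module K A]

/-- The weighted binomial coefficient `u (u - w) ⋯ (u - (k - 1) w) / k!`, which is the divided power
`u ^ k / k!` for `w = 0` and the binomial coefficient of `u` for `w = 1`. As `A` need not be
associative, the factors are multiplied on from the left, one at a time. -/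
def weightedChoose (w : K) (u : A) : ℕ → A
  | 0 => 1
  | k + 1 => ((k : K) + 1)⁻¹ • (u * weightedChoose w u k - (k * w) • weightedChoose w u k)

theorem succ_smul_weightedChoose_succ [CharZero K] (w : K) (u : A) (k : ℕ) :
    ((k : K) + 1) • weightedChoose w u (k + 1) =
      u * weightedChoose w u k - (k * w) • weightedChoose w u k := by
  rw [weightedChoose, smul_inv_smul₀ k.cast_add_one_ne_zero]

theorem IsDerivationOfWeight.apply_weightedChoose_succ [CharZero K] {w : K} {δ : A →ₗ[K] A}
    (hδ : IsDerivationOfWeight w δ) {u : A} (hu : δ u = 1) (k : ℕ) :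
    δ (weightedChoose w u (k + 1)) = weightedChoose w u k := by
  induction k with
  | zero => simp [weightedChoose, hu]
  | succ k ih =>
    set q := weightedChoose w u
    have ne_zero : ((k + 1 : ℕ) : K) + 1 ≠ 0 := (k + 1).cast_add_one_ne_zero
    refine (smul_right_inj ne_zero).1 ?_
    calc (((k + 1 : ℕ) : K) + 1) • δ (q (k + 2))
        = δ (u * q (k + 1) - ((k + 1 : ℕ) * w) • q (k + 1)) := by
          rw [← map_smul, succ_smul_weightedChoose_succ]
      _ = q (k + 1) + (u * q k - (k * w) • q k) := by
          rw [map_sub, map_smul, hδ, hu, ih, one_mul, one_mul]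
          push_cast
          module
      _ = (((k + 1 : ℕ) : K) + 1) • q (k + 1) := by
          rw [← succ_smul_weightedChoose_succ]
          push_cast
          module

theorem IsDerivationOfWeight.maxGenEigenspace_zero_le_range [CharZero K] {w : K}
    {δ : A →ₗ[K] A} (hδ : IsDerivationOfWeight w δ) (h1 : (1 : A) ∈ LinearMap.range δ) :
    Module.End.maxGenEigenspace δ 0 ≤ LinearMap.range δ := by
  obtain ⟨u, hu⟩ := h1
  intro a ha
  obtain ⟨n, hn⟩ := (Module.End.mem_maxGenEigenspace δ 0 a).1 ha
  rw [zero_smul, sub_zero] at hn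
  simpa only [weightedChoose, one_mul] using
    hδ.mul_mem_range_of_pow_apply_eq_zero (hδ.apply_weightedChoose_succ hu) hn 0

end WeightedBinomial

theorem proposition1p4_general {K A : Type*} [Field K] [CharZero K] [NonAssocRing A] [Module K A]
    {w : K} {δ : A →ₗ[K] A} (hLF : IsLocallyFiniteEnd δ) (hδ : IsDerivationOfWeight w δ) :
    (1 : A) ∈ LinearMap.range δ ↔ Function.Surjective δ := by
  refine ⟨fun h1 => LinearMap.range_eq_top.1 ?_, fun hsurj => hsurj 1⟩
  rw [← hLF.maxGenEigenspace_zero_sup_range, right_eq_sup]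
  exact hδ.maxGenEigenspace_zero_le_range h1

theorem proposition1p4 {K : Type*} {A : Type*} [Field K] [CharZero K] [Ring A] [Algebra K A]
    (δ : A →ₗ[K] A) (hLF : IsLocallyFiniteEnd δ)
    (hδ : IsKDerivation δ ∨ IsKEDerivation δ) :
    (1 : A) ∈ LinearMap.range δ ↔ Function.Surjective δ := by
  rcases hδ with hδ | hδ
  · exact proposition1p4_general hLF hδ.isDerivationOfWeight_zero
  · exact proposition1p4_general hLF hδ.isDerivationOfWeight_neg_one
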